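/- Let $G$ be a non-compact real reductive Lie group: $G$ has finitely many connected components, $\mathfrak g=[\mathfrak g,\mathfrak g]\oplus\mathfrak z(\mathfrak g)$ with $[\mathfrak g,\mathfrak g]$ semisimple, and $G$ carries a Cartan involution $\theta$, i.e. an involutive Lie group automorphism whose fixed point group $K$ is compact and such that, with $\mathfrak k$ and $\mathfrak p$ the $+1$ and $-1$ eigenspaces of $d\theta$ on $\mathfrak g$, the map $K\times\mathfrak p\to G$, $(k,v)\mapsto k\exp v$, is a diffeomorphism. Fix an $\mathrm{Ad}(K)$-invariant scalar product on $\mathfrak p$ and let $S(\mathfrak p)$ be its unit sphere. Let $\mathscr M$ be a Hausdorff topological space with a continuous $G$-action, with stabilizers $G_x$, and let $\Psi:\mathscr M\times G\to\mathbb R$ be a Kempf–Ness function for $(\mathscr M,G,K)$, i.e. for all $x\in\mathscr M$, $g,h\in G$, $k\in K$, $v\in\mathfrak p$, $t\in\mathbb R$: (P1) $\Psi(x,\cdot)$ is smooth on $G$; (P2) $\Psi(x,kg)=\Psi(x,g)$; (P3) $\frac{d^2}{dt^2}\Psi(x,\exp(tv))\ge 0$, and $\frac{d^2}{dt^2}\big|_{t=0}\Psi(x,\exp(tv))=0$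 if and only if $\exp(\mathbb R v)\subset G_x$; (P4) $\Psi(x,g)+\Psi(gx,h)=\Psi(x,hg)$; (P5) the gradient map $\mathfrak F:\mathscr M\to\mathfrak p^*$, $\langle\mathfrak F(x),v\rangle=\frac{d}{dt}\big|_{t=0}\Psi(x,\exp(tv))$, is continuous. Call $x\in\mathscr M$ stable if $Gx\cap\mathfrak F^{-1}(0)\ne\emptyset$ and the Lie algebra $\mathfrak g_x$ of $G_x$ is conjugate under $\mathrm{Ad}(G)$ to a subalgebra of $\mathfrak k$. Then: (a) for all $x\in\mathscr M$ and $v\in\mathfrak p$ the limit $\Lambda(x,v)=\lim_{t\to+\infty}\frac{d}{dt}\Psi(x,\exp(tv))$ exists in $(-\infty,+\infty]$; (b) the function $\Lambda:\mathscr M\times S(\mathfrak p)\to(-\infty,+\infty]$ is lower semicontinuous; (c) the set of stable points is open in $\mathscr M$. -/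

import Mathlib

open scoped Manifold ContDiff Topology
open Filter

noncomputable section

namespace KempfNess

/-! ### Real reductive Lie groups -/

section Group

/-- A smooth real Lie group is a Lie group of the finite regularity that Mathlib uses for its
Lie algebra. -/
instance lieGroup_minSmoothness {n : ℕ} {G : Type*} [TopologicalSpace G]
    [ChartedSpace (EuclideanSpace ℝ (Fin n)) G] [Group G] [LieGroup (𝓡 n) ∞ G] :
    LieGroup (𝓡 n) (minSmoothness ℝ 3) G :=
  LieGroup.of_le (m := minSmoothness ℝ 3) (n := ∞)
    (by simp only [minSmoothness_of_isRCLikeNormedField]; exact WithTop.coe_le_coe.2 (le_top : (3 : ℕ∞) ≤ ⊤))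

variable {n : ℕ} {G : Type*} [TopologicalSpace G]
  [ChartedSpace (EuclideanSpace ℝ (Fin n)) G] [Group G]

open Classical in
/-- The Lie group exponential map: `lieExp v = γ 1`, where `γ` is the integral curve, starting at
the identity, of the left-invariant vector field of `v`. (On a Hausdorff Lie group this curve
exists and is unique, so the default value is never used.) -/
def lieExp (v : GroupLieAlgebra (𝓡 n) G) : G :=
  if h : ∃ γ : ℝ → G, γ 0 = 1 ∧ IsMIntegralCurve γ
      (mulInvariantVectorField v : (g : G) → TangentSpace (𝓡 n) g)
  then h.choose 1 else 1

/-- The differential at the identity of a map `φ : G → G` with `φ 1 = 1`, as an endomorphism of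
the Lie algebra. -/
def diffOne (φ : G → G) : GroupLieAlgebra (𝓡 n) G →ₗ[ℝ] GroupLieAlgebra (𝓡 n) G :=
  (mfderiv (𝓡 n) (𝓡 n) φ 1).toLinearMap

/-- The adjoint representation of `G` on its Lie algebra. -/
def Ad (g : G) : GroupLieAlgebra (𝓡 n) G →ₗ[ℝ] GroupLieAlgebra (𝓡 n) G :=
  diffOne fun h => g * h * g⁻¹

/-- The Lie algebra `{v | exp (ℝ v) ⊆ H}` of a (closed) subgroup `H` of `G`. -/
def lieAlgebraOf (H : Subgroup G) : Set (GroupLieAlgebra (𝓡 n) G) :=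
  {v | ∀ t : ℝ, lieExp (t • v) ∈ H}

/-- The subgroup `K` of fixed points of an endomorphism `θ` of `G`. -/
def fixedSubgroup (θ : G →* G) : Subgroup G := θ.eqLocus (MonoidHom.id G)

/-- The `+1`-eigenspace `𝔨` of the differential of `θ`. -/
def kSpace (θ : G →* G) : Submodule ℝ (GroupLieAlgebra (𝓡 n) G) :=
  LinearMap.ker (diffOne (n := n) θ - LinearMap.id)

/-- The `-1`-eigenspace `𝔭` of the differential of `θ`. -/
def pSpace (θ : G →* G) : Submodule ℝ (GroupLieAlgebra (𝓡 n) G) :=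
  LinearMap.ker (diffOne (n := n) θ + LinearMap.id)

variable (n) in
/-- `θ` is a Cartan involution of `G`: an involutive automorphism of the Lie group `G`, with
compact fixed point group `K`, such that `K × 𝔭 → G`, `(k, v) ↦ k exp v`, is a diffeomorphism.
As `K` is an embedded submanifold of `G`, the last condition says that `exp` is smooth on `𝔭` and
that the map has a two-sided inverse `g ↦ (κ g, ν g)` whose components are smooth as maps to `G`
and to `𝔤` (a copy of `ℝⁿ`). -/
structure IsCartanInvolution (θ : G →* G) : Prop where
  involutive : Function.Involutive θ
  smooth : ContMDiff (𝓡 n) (𝓡 n) ∞ θ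
  isCompact_fixed : IsCompact (fixedSubgroup θ : Set G)
  smooth_exp : ContMDiffOn (𝓡 n) (𝓡 n) ∞
    (fun v : EuclideanSpace ℝ (Fin n) => (lieExp (n := n) v : G))
    {v | v ∈ pSpace (n := n) θ}
  cartan_decomposition : ∃ (κ : G → G) (ν : G → EuclideanSpace ℝ (Fin n)),
    ContMDiff (𝓡 n) (𝓡 n) ∞ κ ∧ ContMDiff (𝓡 n) (𝓡 n) ∞ ν ∧
    (∀ g, κ g ∈ fixedSubgroup θ ∧ ν g ∈ pSpace (n := n) θ ∧
      κ g * lieExp (n := n) (ν g) = g) ∧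
    ∀ k ∈ fixedSubgroup θ, ∀ v ∈ pSpace (n := n) θ,
      κ (k * lieExp v) = k ∧ ν (k * lieExp v) = v

variable (n) in
/-- `(G, θ)` is a non-compact real reductive Lie group with Cartan involution `θ`: `G` has finitely
many connected components, and its Lie algebra is the direct sum of its centre and its derived
algebra, which is semisimple. -/
structure IsNoncompactReductive [LieGroup (𝓡 n) ∞ G] (θ : G →* G) : Prop where
  noncompact : NoncompactSpace G
  finite_components : Finite (ConnectedComponents G)
  isCompl : IsCompl (LieAlgebra.derivedSeries ℝ (GroupLieAlgebra (𝓡 n) G) 1)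
    (LieAlgebra.center ℝ (GroupLieAlgebra (𝓡 n) G))
  semisimple : LieAlgebra.IsSemisimple ℝ
    (LieAlgebra.derivedSeries ℝ (GroupLieAlgebra (𝓡 n) G) 1)
  cartan : IsCartanInvolution n θ

/-- `B` is an `Ad(K)`-invariant scalar product on `𝔭`. -/
structure IsInvariantScalarProduct (θ : G →* G)
    (B : LinearMap.BilinForm ℝ (pSpace (n := n) θ)) : Prop where
  symm : ∀ v w, B v w = B w v
  pos : ∀ v, v ≠ 0 → 0 < B v v
  invariant : ∀ k ∈ fixedSubgroup θ, ∀ v w v' w' : pSpace (n := n) θ,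
    (v' : GroupLieAlgebra (𝓡 n) G) = Ad k v → (w' : GroupLieAlgebra (𝓡 n) G) = Ad k w →
    B v' w' = B v w

/-! ### Kempf-Ness functions and stability -/

variable {M : Type*} [TopologicalSpace M] [MulAction G M]

/-- The gradient map `𝔉 : M → 𝔭*`: `𝔉 x` is the restriction to `𝔭` of the differential of
`Ψ(x, ·)` at the identity, that is `⟨𝔉 x, v⟩ = d/dt|₀ Ψ(x, exp (t v))`. -/
def gradientMap (θ : G →* G) (Ψ : M → G → ℝ) (x : M) : pSpace (n := n) θ →L[ℝ] ℝ :=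
  (mfderiv (𝓡 n) 𝓘(ℝ, ℝ) (Ψ x) 1 : GroupLieAlgebra (𝓡 n) G →L[ℝ] ℝ).comp
    (pSpace (n := n) θ).subtypeL

variable (n) in
/-- `Ψ : M × G → ℝ` is a Kempf-Ness function for `(M, G, K)`. -/
structure IsKempfNessFunction (θ : G →* G) (Ψ : M → G → ℝ) : Prop where
  smooth : ∀ x, ContMDiff (𝓡 n) 𝓘(ℝ, ℝ) ∞ (Ψ x)
  left_invariant : ∀ x, ∀ k ∈ fixedSubgroup θ, ∀ g, Ψ x (k * g) = Ψ x g
  second_deriv_nonneg : ∀ x, ∀ v ∈ pSpace (n := n) θ, ∀ t : ℝ,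
    0 ≤ iteratedDeriv 2 (fun s : ℝ => Ψ x (lieExp (s • v))) t
  second_deriv_eq_zero_iff : ∀ x, ∀ v ∈ pSpace (n := n) θ,
    iteratedDeriv 2 (fun s : ℝ => Ψ x (lieExp (s • v))) 0 = 0 ↔
      ∀ s : ℝ, lieExp (s • v) ∈ MulAction.stabilizer G x
  cocycle : ∀ x g h, Ψ x g + Ψ (g • x) h = Ψ x (h * g)
  continuous_gradientMap : Continuous (gradientMap (n := n) θ Ψ)

/-- The function `t ↦ d/dt Ψ(x, exp (t v))`,
with values in `[-∞, +∞]`. -/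
def weightSlope (Ψ : M → G → ℝ) (x : M) (v : GroupLieAlgebra (𝓡 n) G) (t : ℝ) : EReal :=
  ((deriv (fun s : ℝ => Ψ x (lieExp (s • v))) t : ℝ) : EReal)

/-- `Λ(x, v) = lim_{t → +∞} d/dt Ψ(x, exp (t v))`, with values in `[-∞, +∞]`. -/
def Lam (Ψ : M → G → ℝ) (x : M) (v : GroupLieAlgebra (𝓡 n) G) : EReal :=
  limUnder atTop (weightSlope Ψ x v)

variable (n) in
/-- `x` is polystable if its orbit meets the zero set of the gradient map. -/
def IsPolystable (θ : G →* G) (Ψ : M → G → ℝ) (x : M) : Prop :=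
  ∃ y ∈ MulAction.orbit G x, gradientMap (n := n) θ Ψ y = 0

variable (n) in
/-- `x` is stable if it is polystable and the Lie algebra `𝔤ₓ` of its stabilizer is conjugate to a
subalgebra of `𝔨`, that is `Ad g (𝔤ₓ) ⊆ 𝔨` for some `g` (`Ad g` is an automorphism of `𝔤`, so
`Ad g (𝔤ₓ)` is always a subalgebra). -/
def IsStable (θ : G →* G) (Ψ : M → G → ℝ) (x : M) : Prop :=
  IsPolystable n θ Ψ x ∧
    ∃ g : G, ∀ v ∈ lieAlgebraOf (n := n) (MulAction.stabilizer G x), Ad g v ∈ kSpace (n := n) θ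

end Group

end KempfNess

end

/-!
By (P3), `t ↦ d/dt Ψ(x, exp (t v))` is nondecreasing, so `Λ(x, v)` is its supremum over `t`. By the
cocycle identity this slope equals `⟨𝔉 (exp (t v) x), v⟩`, which is jointly continuous in `(x, v)`,
and a supremum of continuous functions is lower semicontinuous.

The openness of the stable locus rests on the equivalence: `x` is stable if and only if `Ψ(x, ·)` is
proper and bounded below, that is, tends to `+∞` at infinity in `G`. If `𝔉 y = 0`, then `1` is a
minimum of `Ψ(y, ·)`, and a direction `v ∈ 𝔭` in which the slope does not become positive lies in
the Lie algebra of the stabilizer of `y`; so `Ψ(y, ·)` is proper exactly when that Lie algebra meets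
`𝔭` trivially. Conversely a proper `Ψ(x, ·)` attains its minimum at some `g`, where `𝔉 (g x) = 0`.
By convexity and compactness of the unit sphere of `𝔭`, properness means that at some common time
`t` all slopes in unit directions are positive, and by compactness again this persists for nearby
`x`.
-/

noncomputable section

namespace KempfNess

lemma t2Space_of_lieGroup {𝕜 : Type*} [NontriviallyNormedField 𝕜] {E : Type*}
    [NormedAddCommGroup E] [NormedSpace 𝕜 E] {H : Type*} [TopologicalSpace H] [T1Space H]
    (I : ModelWithCorners 𝕜 E H) (r : WithTop ℕ∞) (G : Type*) [TopologicalSpace G]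
    [ChartedSpace H G] [Group G] [LieGroup I r G] : T2Space G := by
  have := topologicalGroup_of_lieGroup I r (G := G)
  have := ChartedSpace.t1Space H G
  infer_instance

section InvariantVectorField

variable {𝕜 : Type*} [NontriviallyNormedField 𝕜]
  {E : Type*} [NormedAddCommGroup E] [NormedSpace 𝕜 E] {H : Type*} [TopologicalSpace H]
  {I : ModelWithCorners 𝕜 E H}
  {G : Type*} [TopologicalSpace G] [ChartedSpace H G] [Group G]
  {E' : Type*} [NormedAddCommGroup E'] [NormedSpace 𝕜 E'] {H' : Type*} [TopologicalSpace H']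
  {I' : ModelWithCorners 𝕜 E' H'}
  {G' : Type*} [TopologicalSpace G'] [ChartedSpace H' G'] [Group G']

lemma mulInvariantVectorField_one (v : GroupLieAlgebra I G) :
    mulInvariantVectorField v (1 : G) = v := by
  have h : mfderiv I I ((1 : G) * ·) 1 = ContinuousLinearMap.id 𝕜 E :=
    (mfderiv_congr (funext one_mul)).trans mfderiv_id
  exact DFunLike.congr_fun h v

variable [ContMDiffMul I 1 G]

lemma mfderiv_mul_left_mulInvariantVectorField (v : GroupLieAlgebra I G) (g h : G) :
    mfderiv I I (g * ·) h (mulInvariantVectorField v h) = mulInvariantVectorField v (g * h) := by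
  have hcomp : mfderiv I I ((g * ·) ∘ (h * ·)) 1 v = mfderiv I I (g * h * ·) 1 v :=
    DFunLike.congr_fun (F := E →L[𝕜] E) (mfderiv_congr (funext fun x => (mul_assoc g h x).symm)) v
  exact (mfderiv_comp_apply_of_eq (I := I) (I' := I) (I'' := I) (x := (1 : G)) (g := (g * ·))
    (f := (h * ·)) mdifferentiableAt_mul_left mdifferentiableAt_mul_left (mul_one h)
    v).symm.trans hcomp

lemma mfderiv_monoidHom_mulInvariantVectorField [ContMDiffMul I' 1 G'] {φ : G →* G'}
    (hφ : MDifferentiable I I' φ) (v : GroupLieAlgebra I G) (g : G) :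
    mfderiv I I' φ g (mulInvariantVectorField v g) =
      mulInvariantVectorField (I := I') (mfderiv I I' φ 1 v) (φ g) := by
  have hcomp : mfderiv I I' (φ ∘ (g * ·)) 1 v = mfderiv I I' ((φ g * ·) ∘ φ) 1 v :=
    DFunLike.congr_fun (F := E →L[𝕜] E') (mfderiv_congr (funext fun x => map_mul φ g x)) v
  have hleft := mfderiv_comp_apply_of_eq (I := I) (I' := I) (I'' := I') (x := (1 : G))
    (g := φ) (f := (g * ·)) (hφ g) mdifferentiableAt_mul_left (mul_one g) v
  have hright := mfderiv_comp_apply_of_eq (I := I) (I' := I') (I'' := I') (x := (1 : G))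
    (g := (φ g * ·)) (f := φ) mdifferentiableAt_mul_left (hφ 1) (map_one φ) v
  exact hleft.symm.trans (hcomp.trans hright)

end InvariantVectorField

section IntegralCurve

variable {E : Type*} [NormedAddCommGroup E] [NormedSpace ℝ E] {H : Type*} [TopologicalSpace H]
  {I : ModelWithCorners ℝ E H} {M : Type*} [TopologicalSpace M] [ChartedSpace H M]
  {E' : Type*} [NormedAddCommGroup E'] [NormedSpace ℝ E'] {H' : Type*} [TopologicalSpace H']
  {I' : ModelWithCorners ℝ E' H'} {N : Type*} [TopologicalSpace N] [ChartedSpace H' N]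

lemma isMIntegralCurveOn_comp_of_mfderiv {X : (x : M) → TangentSpace I x}
    {Y : (y : N) → TangentSpace I' y} {φ : M → N} (hφ : MDifferentiable I I' φ)
    (hXY : ∀ x, mfderiv I I' φ x (X x) = Y (φ x)) {γ : ℝ → M} {s : Set ℝ}
    (hγ : IsMIntegralCurveOn γ X s) : IsMIntegralCurveOn (φ ∘ γ) Y s := fun t ht =>
  ((hφ (γ t)).hasMFDerivAt.comp_hasMFDerivWithinAt t (hγ t ht)).congr_mfderiv <|
    ContinuousLinearMap.ext fun r : ℝ => ((mfderiv I I' φ (γ t)).map_smul r _).trans <|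
      congrArg (fun w : E' => r • w) (hXY _)

lemma isMIntegralCurve_comp_of_mfderiv {X : (x : M) → TangentSpace I x}
    {Y : (y : N) → TangentSpace I' y} {φ : M → N} (hφ : MDifferentiable I I' φ)
    (hXY : ∀ x, mfderiv I I' φ x (X x) = Y (φ x)) {γ : ℝ → M}
    (hγ : IsMIntegralCurve γ X) : IsMIntegralCurve (φ ∘ γ) Y :=
  isMIntegralCurve_iff_isMIntegralCurveOn.2
    (isMIntegralCurveOn_comp_of_mfderiv hφ hXY (isMIntegralCurve_iff_isMIntegralCurveOn.1 hγ))

lemma hasDerivAt_comp_isMIntegralCurve {F : Type*} [NormedAddCommGroup F] [NormedSpace ℝ F]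
    {X : (x : M) → TangentSpace I x} {γ : ℝ → M} (hγ : IsMIntegralCurve γ X) {f : M → F} {t : ℝ}
    (hf : MDifferentiableAt I 𝓘(ℝ, F) f (γ t)) :
    HasDerivAt (f ∘ γ)
      ((mfderiv I 𝓘(ℝ, F) f (γ t) : TangentSpace I (γ t) →L[ℝ] F) (X (γ t))) t := by
  let L : E →L[ℝ] F := mfderiv I 𝓘(ℝ, F) f (γ t)
  let X₀ : E := X (γ t)
  have hfγ : HasFDerivAt (f ∘ γ) (L ∘L (1 : ℝ →L[ℝ] ℝ).smulRight X₀) t :=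
    hasMFDerivAt_iff_hasFDerivAt.1 (hf.hasMFDerivAt.comp t (hγ t))
  exact hfγ.hasDerivAt.congr_deriv (congrArg L (one_smul ℝ X₀))

variable {G : Type*} [TopologicalSpace G] [ChartedSpace H G] [Group G]

lemma eq_of_isMIntegralCurve_mulInvariantVectorField {v w : GroupLieAlgebra I G} {γ : ℝ → G}
    (h₀ : γ 0 = 1)
    (hv : IsMIntegralCurve γ (mulInvariantVectorField v : (g : G) → TangentSpace I g))
    (hw : IsMIntegralCurve γ (mulInvariantVectorField w : (g : G) → TangentSpace I g)) :
    v = w := by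
  have h : (mulInvariantVectorField v (γ 0) : TangentSpace I (γ 0)) =
      mulInvariantVectorField w (γ 0) :=
    (one_smul ℝ _).symm.trans <| (DFunLike.congr_fun (F := ℝ →L[ℝ] E)
      (hasMFDerivAt_unique (hv 0) (hw 0)) (1 : ℝ)).trans (one_smul ℝ _)
  rw [h₀] at h
  rwa [mulInvariantVectorField_one, mulInvariantVectorField_one] at h

variable [LieGroup I (minSmoothness ℝ 3) G]

lemma contMDiff_one_mulInvariantVectorField (v : GroupLieAlgebra I G) :
    ContMDiff I I.tangent 1
      (fun g : G => (⟨g, mulInvariantVectorField v g⟩ : TangentBundle I G)) :=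
  (contMDiff_mulInvariantVectorField v).of_le
    (one_le_two.trans le_minSmoothness)

theorem exists_isMIntegralCurve_mulInvariantVectorField [CompleteSpace E] [BoundarylessManifold I G]
    [T2Space G] (v : GroupLieAlgebra I G) :
    ∃ γ : ℝ → G, γ 0 = 1 ∧
      IsMIntegralCurve γ (mulInvariantVectorField v : (g : G) → TangentSpace I g) := by
  have : LieGroup I 1 G :=
    LieGroup.of_le (n := minSmoothness ℝ 3)
      ((by norm_num : (1 : WithTop ℕ∞) ≤ 3).trans le_minSmoothness)
  obtain ⟨γ, hγ₀, hγ⟩ := exists_isMIntegralCurveAt_of_contMDiffAt_boundaryless (t₀ := 0)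
    (x₀ := (1 : G)) (contMDiff_one_mulInvariantVectorField v).contMDiffAt
  obtain ⟨ε, hε, hγε⟩ := isMIntegralCurveAt_iff'.1 hγ
  rw [Real.ball_eq_Ioo, zero_sub, zero_add] at hγε
  exact exists_isMIntegralCurve_of_isMIntegralCurveOn (contMDiff_one_mulInvariantVectorField v) hε
    (fun g => ⟨fun t => g * γ t, by simp [hγ₀], isMIntegralCurveOn_comp_of_mfderiv
      (fun _ => mdifferentiableAt_mul_left) (mfderiv_mul_left_mulInvariantVectorField v g) hγε⟩) 1

end IntegralCurve

section Exponential

variable {n : ℕ} {G : Type*} [TopologicalSpace G]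
  [ChartedSpace (EuclideanSpace ℝ (Fin n)) G] [Group G] [LieGroup (𝓡 n) ∞ G]

lemma eq_of_isMIntegralCurve_of_apply_zero {v : GroupLieAlgebra (𝓡 n) G} {γ γ' : ℝ → G}
    (hγ : IsMIntegralCurve γ (mulInvariantVectorField v : (g : G) → TangentSpace (𝓡 n) g))
    (hγ' : IsMIntegralCurve γ' (mulInvariantVectorField v : (g : G) → TangentSpace (𝓡 n) g))
    (h₀ : γ 0 = γ' 0) : γ = γ' :=
  have := t2Space_of_lieGroup (𝓡 n) ∞ G
  isMIntegralCurve_Ioo_eq_of_contMDiff_boundaryless (t₀ := 0)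
    (contMDiff_one_mulInvariantVectorField v) hγ hγ' h₀

lemma lieExp_eq {v : GroupLieAlgebra (𝓡 n) G} {γ : ℝ → G} (h₀ : γ 0 = 1)
    (hγ : IsMIntegralCurve γ (mulInvariantVectorField v : (g : G) → TangentSpace (𝓡 n) g)) :
    lieExp v = γ 1 := by
  have hex : ∃ γ : ℝ → G, γ 0 = 1 ∧ IsMIntegralCurve γ
      (mulInvariantVectorField v : (g : G) → TangentSpace (𝓡 n) g) := ⟨γ, h₀, hγ⟩
  rw [lieExp, dif_pos hex]
  exact congrFun (eq_of_isMIntegralCurve_of_apply_zero hex.choose_spec.2 hγ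
    (hex.choose_spec.1.trans h₀.symm)) 1

lemma lieExp_smul_eq {v : GroupLieAlgebra (𝓡 n) G} {γ : ℝ → G} (h₀ : γ 0 = 1)
    (hγ : IsMIntegralCurve γ (mulInvariantVectorField v : (g : G) → TangentSpace (𝓡 n) g))
    (t : ℝ) : lieExp (t • v) = γ t := by
  have hγt := hγ.comp_mul t
  rw [← mulInvariantVectorField_smul] at hγt
  simpa using lieExp_eq (by simpa using h₀) hγt

lemma isMIntegralCurve_lieExp (v : GroupLieAlgebra (𝓡 n) G) :
    IsMIntegralCurve (fun t : ℝ => (lieExp (t • v) : G))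
      (mulInvariantVectorField v : (g : G) → TangentSpace (𝓡 n) g) := by
  have := t2Space_of_lieGroup (𝓡 n) ∞ G
  obtain ⟨γ, h₀, hγ⟩ := exists_isMIntegralCurve_mulInvariantVectorField v
  simpa only [lieExp_smul_eq h₀ hγ] using hγ

@[simp]
lemma lieExp_zero : (lieExp (0 : GroupLieAlgebra (𝓡 n) G) : G) = 1 := by
  have := t2Space_of_lieGroup (𝓡 n) ∞ G
  obtain ⟨γ, h₀, hγ⟩ := exists_isMIntegralCurve_mulInvariantVectorField
    (0 : GroupLieAlgebra (𝓡 n) G)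
  simpa [h₀] using lieExp_smul_eq h₀ hγ 0

lemma lieExp_add_smul (s t : ℝ) (v : GroupLieAlgebra (𝓡 n) G) :
    (lieExp ((s + t) • v) : G) = lieExp (s • v) * lieExp (t • v) := by
  have hmul := isMIntegralCurve_comp_of_mfderiv (I' := 𝓡 n) (fun _ => mdifferentiableAt_mul_left)
    (mfderiv_mul_left_mulInvariantVectorField v (lieExp (s • v))) (isMIntegralCurve_lieExp v)
  have hadd := (isMIntegralCurve_lieExp v).comp_add s
  simpa [add_comm] using congrFun (eq_of_isMIntegralCurve_of_apply_zero hadd hmul (by simp)) t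

lemma lieExp_map {φ : G →* G} (hφ : MDifferentiable (𝓡 n) (𝓡 n) φ)
    (v : GroupLieAlgebra (𝓡 n) G) : φ (lieExp v) = lieExp (diffOne (n := n) φ v) := by
  have hmap : IsMIntegralCurve (fun t : ℝ => φ (lieExp (t • v))) (mulInvariantVectorField
      (diffOne (n := n) φ v) : (g : G) → TangentSpace (𝓡 n) g) :=
    isMIntegralCurve_comp_of_mfderiv hφ (mfderiv_monoidHom_mulInvariantVectorField hφ v)
      (isMIntegralCurve_lieExp v)
  simpa using (lieExp_eq (by simp) hmap).symm

lemma lieExp_Ad (g : G) (v : GroupLieAlgebra (𝓡 n) G) :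
    (lieExp (Ad g v) : G) = g * lieExp v * g⁻¹ := by
  have hconj : ContMDiff (𝓡 n) (𝓡 n) ∞ (fun h : G => g * h * g⁻¹) :=
    (contMDiff_const.mul contMDiff_id).mul contMDiff_const
  exact (lieExp_map (φ := (MulAut.conj g).toMonoidHom) (hconj.mdifferentiable (by simp)) v).symm

lemma eq_of_forall_lieExp_smul_eq {v w : GroupLieAlgebra (𝓡 n) G}
    (h : ∀ t : ℝ, (lieExp (t • v) : G) = lieExp (t • w)) : v = w :=
  eq_of_isMIntegralCurve_mulInvariantVectorField (by simp) (isMIntegralCurve_lieExp v)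
    (by simpa only [h] using isMIntegralCurve_lieExp w)

lemma hasDerivAt_comp_lieExp_smul_zero {F : Type*} [NormedAddCommGroup F] [NormedSpace ℝ F]
    {f : G → F} (hf : MDifferentiableAt (𝓡 n) 𝓘(ℝ, F) f 1) (v : GroupLieAlgebra (𝓡 n) G) :
    HasDerivAt (fun t : ℝ => f (lieExp (t • v)))
      ((mfderiv (𝓡 n) 𝓘(ℝ, F) f 1 : GroupLieAlgebra (𝓡 n) G →L[ℝ] F) v) 0 := by
  have mfderiv_of_eq_one : ∀ g : G, g = 1 →
      (mfderiv (𝓡 n) 𝓘(ℝ, F) f g : TangentSpace (𝓡 n) g →L[ℝ] F) (mulInvariantVectorField v g) =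
        (mfderiv (𝓡 n) 𝓘(ℝ, F) f 1 : GroupLieAlgebra (𝓡 n) G →L[ℝ] F) v := by
    rintro _ rfl
    rw [mulInvariantVectorField_one]
  rw [← mfderiv_of_eq_one (lieExp ((0 : ℝ) • v)) (by simp)]
  exact hasDerivAt_comp_isMIntegralCurve (isMIntegralCurve_lieExp v) (by simpa using hf)

end Exponential

section RadialConvexity

lemma tangent_le_of_convexOn {S : Set ℝ} {f : ℝ → ℝ} (hf : ConvexOn ℝ S f) {a b : ℝ} (ha : a ∈ S)
    (hb : b ∈ S) (hfa : DifferentiableAt ℝ f a) : f a + deriv f a * (b - a) ≤ f b := by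
  rcases lt_trichotomy a b with hab | rfl | hba
  · have hslope := hf.deriv_le_slope ha hb hab hfa
    rw [slope_def_field, le_div_iff₀ (sub_pos.2 hab)] at hslope
    linarith
  · simp
  · have hslope := hf.slope_le_deriv hb ha hba hfa
    rw [slope_def_field, div_le_iff₀ (sub_pos.2 hba)] at hslope
    linarith

lemma deriv_eq_zero_of_monotone_of_le {g : ℝ → ℝ} (hg : Monotone g) {a b : ℝ} (hab : a < b)
    (hga : DifferentiableAt ℝ g a) (hle : g b ≤ g a) : deriv g a = 0 := by
  have hconst : ∀ s ∈ Set.Icc a b, g s = g a := fun s hs =>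
    le_antisymm ((hg hs.2).trans hle) (hg hs.1)
  have hzero : HasDerivWithinAt g 0 (Set.Icc a b) a :=
    (hasDerivWithinAt_const a (Set.Icc a b) (g a)).congr hconst rfl
  exact (uniqueDiffOn_Icc hab a (Set.left_mem_Icc.2 hab.le)).eq_deriv _
    hga.hasDerivAt.hasDerivWithinAt hzero

variable {V : Type*} [NormedAddCommGroup V] [NormedSpace ℝ V] {f : V → ℝ}

/-- The derivative at time `t` of `f` along the line `s ↦ s • v`. -/
def radialDeriv (f : V → ℝ) (v : V) (t : ℝ) : ℝ :=
  deriv (fun s : ℝ => f (s • v)) t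

lemma radialDeriv_eq_zero_of_forall_le {v : V} {t : ℝ} (h : ∀ w, f (t • v) ≤ f w) :
    radialDeriv f v t = 0 :=
  IsLocalMin.deriv_eq_zero (Eventually.of_forall fun s => h (s • v))

/-- A function is radially convex if its restrictions to the lines through the origin are
differentiable and convex. -/
structure IsRadiallyConvex (f : V → ℝ) : Prop where
  differentiable (v : V) : Differentiable ℝ fun t : ℝ => f (t • v)
  convexOn (v : V) : ConvexOn ℝ Set.univ fun t : ℝ => f (t • v)

namespace IsRadiallyConvex

lemma monotone_radialDeriv (hf : IsRadiallyConvex f) (v : V) : Monotone (radialDeriv f v) :=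
  monotoneOn_univ.1 ((hf.convexOn v).monotoneOn_deriv fun t _ => hf.differentiable v t)

lemma tangent_le (hf : IsRadiallyConvex f) (v : V) (a b : ℝ) :
    f (a • v) + radialDeriv f v a * (b - a) ≤ f (b • v) :=
  tangent_le_of_convexOn (hf.convexOn v) (Set.mem_univ a) (Set.mem_univ b) (hf.differentiable v a)

lemma le_apply_smul (hf : IsRadiallyConvex f) {v : V} {δ t r : ℝ} (hδ : δ ≤ radialDeriv f v t)
    (htr : t ≤ r) : f 0 + radialDeriv f v 0 * t + δ * (r - t) ≤ f (r • v) := by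
  have hzero := hf.tangent_le v 0 t
  rw [zero_smul, sub_zero] at hzero
  calc f 0 + radialDeriv f v 0 * t + δ * (r - t)
      ≤ f (t • v) + radialDeriv f v t * (r - t) := by gcongr
    _ ≤ f (r • v) := hf.tangent_le v t r

lemma exists_pos_radialDeriv_of_tendsto (hf : IsRadiallyConvex f)
    (h : Tendsto f (cocompact V) atTop) {v : V} (hv : v ≠ 0) : ∃ t, 0 < radialDeriv f v t := by
  by_contra! hle
  have htop : Tendsto (fun t : ℝ => f (t • v)) atTop atTop :=
    h.comp ((isClosedEmbedding_smul_left hv).tendsto_cocompact.mono_left atTop_le_cocompact)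
  have hanti : Antitone fun t : ℝ => f (t • v) :=
    antitone_of_deriv_nonpos (hf.differentiable v) hle
  obtain ⟨t, ht, hft⟩ :=
    ((eventually_ge_atTop 0).and (htop.eventually_gt_atTop (f ((0 : ℝ) • v)))).exists
  exact hft.not_ge (hanti ht)

variable [ProperSpace V]

lemma exists_forall_sphere_pos_radialDeriv (hf : IsRadiallyConvex f)
    (hcont : ∀ t, Continuous fun v => radialDeriv f v t)
    (h : ∀ v ≠ 0, ∃ t, 0 < radialDeriv f v t) :
    ∃ t, ∀ v ∈ Metric.sphere 0 1, 0 < radialDeriv f v t :=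
  (isCompact_sphere (0 : V) 1).elim_directed_cover (fun t => {v | 0 < radialDeriv f v t})
    (fun t => isOpen_lt continuous_const (hcont t))
    (fun v hv => Set.mem_iUnion.2 (h v (ne_zero_of_mem_unit_sphere ⟨v, hv⟩)))
    (Monotone.directed_le fun _ _ hst v hv => lt_of_lt_of_le hv (hf.monotone_radialDeriv v hst))

lemma tendsto_cocompact_of_forall_sphere_pos_radialDeriv (hf : IsRadiallyConvex f)
    (hcont : ∀ t, Continuous fun v => radialDeriv f v t)
    {t : ℝ} (ht : ∀ v ∈ Metric.sphere 0 1, 0 < radialDeriv f v t) :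
    Tendsto f (cocompact V) atTop := by
  have hS := isCompact_sphere (0 : V) 1
  obtain ⟨δ, hδ, hδ_le⟩ := hS.exists_forall_le' (hcont t).continuousOn ht
  obtain ⟨b, hb⟩ := hS.bddBelow_image (f := fun v => f 0 + radialDeriv f v 0 * t) (by fun_prop)
  have hnorm := tendsto_norm_cocompact_atTop (E := V)
  have hbound : ∀ᶠ v in cocompact V, b + δ * (‖v‖ - t) ≤ f v := by
    filter_upwards [hnorm.eventually_ge_atTop t, hnorm.eventually_gt_atTop 0] with v htv hv
    have hunit : ‖v‖⁻¹ • v ∈ Metric.sphere (0 : V) 1 :=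
      mem_sphere_zero_iff_norm.2 (norm_smul_inv_norm (𝕜 := ℝ) (norm_pos_iff.1 hv))
    have hle := hf.le_apply_smul (hδ_le _ hunit) htv
    rw [smul_inv_smul₀ hv.ne'] at hle
    linarith [hb (Set.mem_image_of_mem _ hunit)]
  exact tendsto_atTop_mono' _ hbound <| tendsto_atTop_add_const_left _ b <|
    (tendsto_atTop_add_const_right _ (-t) hnorm).const_mul_atTop hδ

theorem tfae_tendsto_cocompact_atTop (hf : IsRadiallyConvex f)
    (hcont : ∀ t, Continuous fun v => radialDeriv f v t) :
    List.TFAE [Tendsto f (cocompact V) atTop,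
      ∀ v ≠ 0, ∃ t, 0 < radialDeriv f v t,
      ∃ t, ∀ v ∈ Metric.sphere 0 1, 0 < radialDeriv f v t] := by
  tfae_have 1 → 2 := fun h v hv => hf.exists_pos_radialDeriv_of_tendsto h hv
  tfae_have 2 → 3 := hf.exists_forall_sphere_pos_radialDeriv hcont
  tfae_have 3 → 1 := fun ⟨_, ht⟩ =>
    hf.tendsto_cocompact_of_forall_sphere_pos_radialDeriv hcont ht
  tfae_finish

end IsRadiallyConvex

end RadialConvexity

section CartanInvolution

variable {n : ℕ} {G : Type*} [TopologicalSpace G]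
  [ChartedSpace (EuclideanSpace ℝ (Fin n)) G] [Group G] {θ : G →* G}

/-- The Euclidean norm on `𝔤`, a copy of `ℝⁿ`; it induces the topology that `𝔤` carries as a
tangent space. -/
local instance : NormedAddCommGroup (GroupLieAlgebra (𝓡 n) G) :=
  inferInstanceAs (NormedAddCommGroup (EuclideanSpace ℝ (Fin n)))

local instance : NormedSpace ℝ (GroupLieAlgebra (𝓡 n) G) :=
  inferInstanceAs (NormedSpace ℝ (EuclideanSpace ℝ (Fin n)))

local instance : FiniteDimensional ℝ (GroupLieAlgebra (𝓡 n) G) :=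
  inferInstanceAs (FiniteDimensional ℝ (EuclideanSpace ℝ (Fin n)))

section LieGroup

variable [LieGroup (𝓡 n) ∞ G]

lemma Ad_mul (g h : G) (v : GroupLieAlgebra (𝓡 n) G) : Ad (g * h) v = Ad g (Ad h v) :=
  eq_of_forall_lieExp_smul_eq fun t => by
    simp only [← map_smul, lieExp_Ad, mul_inv_rev, mul_assoc]

lemma Ad_mem_lieAlgebraOf_stabilizer_smul_iff {M : Type*} [MulAction G M] {g : G} {x : M}
    {v : GroupLieAlgebra (𝓡 n) G} :
    Ad g v ∈ lieAlgebraOf (MulAction.stabilizer G (g • x)) ↔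
      v ∈ lieAlgebraOf (MulAction.stabilizer G x) :=
  forall_congr' fun t => by
    rw [← map_smul, lieExp_Ad, MulAction.mem_stabilizer_iff, MulAction.mem_stabilizer_iff,
      mul_smul, mul_smul, inv_smul_smul, smul_left_cancel_iff]

lemma coe_kSpace (hθ : MDifferentiable (𝓡 n) (𝓡 n) θ) :
    (kSpace (n := n) θ : Set (GroupLieAlgebra (𝓡 n) G)) = lieAlgebraOf (fixedSubgroup θ) := by
  ext v
  have hmem : v ∈ kSpace (n := n) θ ↔ diffOne (n := n) θ v = v := by
    simp [kSpace, sub_eq_zero]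
  have hexp : v ∈ lieAlgebraOf (fixedSubgroup θ) ↔
      ∀ t : ℝ, (lieExp (t • diffOne (n := n) θ v) : G) = lieExp (t • v) :=
    forall_congr' fun t => by rw [← map_smul, ← lieExp_map hθ]; rfl
  rw [SetLike.mem_coe, hmem, hexp]
  exact ⟨fun h t => by rw [h], eq_of_forall_lieExp_smul_eq⟩

end LieGroup

namespace IsCartanInvolution

lemma mdifferentiable (hθ : IsCartanInvolution n θ) : MDifferentiable (𝓡 n) (𝓡 n) θ :=
  hθ.smooth.mdifferentiable (by simp)

lemma continuous_lieExp (hθ : IsCartanInvolution n θ) :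
    Continuous fun v : pSpace (n := n) θ => (lieExp (v : GroupLieAlgebra (𝓡 n) G) : G) :=
  hθ.smooth_exp.continuousOn.comp_continuous continuous_subtype_val fun v => v.2

lemma exists_mul_lieExp_eq (hθ : IsCartanInvolution n θ) (g : G) :
    ∃ k ∈ fixedSubgroup θ, ∃ v : pSpace (n := n) θ,
      k * lieExp (v : GroupLieAlgebra (𝓡 n) G) = g := by
  obtain ⟨κ, ν, -, -, h, -⟩ := hθ.cartan_decomposition
  exact ⟨κ g, (h g).1, ⟨ν g, (h g).2.1⟩, (h g).2.2⟩

variable [LieGroup (𝓡 n) ∞ G]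

lemma isClosedEmbedding_lieExp (hθ : IsCartanInvolution n θ) :
    Topology.IsClosedEmbedding
      fun v : pSpace (n := n) θ => (lieExp (v : GroupLieAlgebra (𝓡 n) G) : G) := by
  have := t2Space_of_lieGroup (𝓡 n) ∞ G
  obtain ⟨κ, ν, -, hν, hmem, hinv⟩ := hθ.cartan_decomposition
  have hleft : Function.LeftInverse (fun g => (⟨ν g, (hmem g).2.1⟩ : pSpace (n := n) θ))
      fun v : pSpace (n := n) θ => (lieExp (v : GroupLieAlgebra (𝓡 n) G) : G) := fun v =>
    Subtype.ext ((congrArg ν (one_mul _)).symm.trans (hinv 1 (one_mem _) v v.2).2)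
  exact hleft.isClosedEmbedding (hν.continuous.subtype_mk _) hθ.continuous_lieExp

lemma eq_zero_of_forall_lieExp_smul_mem (hθ : IsCartanInvolution n θ) {C : Set G}
    (hC : IsCompact C) {v : pSpace (n := n) θ}
    (h : ∀ t : ℝ, lieExp (t • (v : GroupLieAlgebra (𝓡 n) G)) ∈ C) : v = 0 := by
  by_contra hv
  have htend := (hθ.isClosedEmbedding_lieExp.comp
    (isClosedEmbedding_smul_left (𝕜 := ℝ) hv)).tendsto_cocompact
  obtain ⟨t, ht⟩ := (htend.eventually hC.compl_mem_cocompact).exists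
  exact ht (h t)

lemma eq_zero_of_Ad_mem_kSpace (hθ : IsCartanInvolution n θ) {g : G} {v : pSpace (n := n) θ}
    (h : Ad g (v : GroupLieAlgebra (𝓡 n) G) ∈ kSpace (n := n) θ) : v = 0 := by
  have := topologicalGroup_of_lieGroup (𝓡 n) ∞ (G := G)
  rw [← SetLike.mem_coe, coe_kSpace hθ.mdifferentiable] at h
  refine hθ.eq_zero_of_forall_lieExp_smul_mem
    (hθ.isCompact_fixed.image (f := fun k => g⁻¹ * k * g) (by fun_prop)) fun t => ⟨_, h t, ?_⟩
  rw [← map_smul, lieExp_Ad]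
  group

open scoped Pointwise in
lemma tendsto_cocompact_iff (hθ : IsCartanInvolution n θ) {α : Type*} {f : G → α}
    (hf : ∀ k ∈ fixedSubgroup θ, ∀ g, f (k * g) = f g) {l : Filter α} :
    Tendsto f (cocompact G) l ↔
      Tendsto (fun v : pSpace (n := n) θ => f (lieExp (v : GroupLieAlgebra (𝓡 n) G)))
        (cocompact _) l := by
  have := topologicalGroup_of_lieGroup (𝓡 n) ∞ (G := G)
  refine ⟨fun h => h.comp hθ.isClosedEmbedding_lieExp.tendsto_cocompact, fun h s hs => ?_⟩
  obtain ⟨C, hC, hCs⟩ := mem_cocompact.1 (h hs)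
  refine mem_cocompact.2
    ⟨_, hθ.isCompact_fixed.mul (hC.image hθ.continuous_lieExp), fun g hg => ?_⟩
  obtain ⟨k, hk, v, rfl⟩ := hθ.exists_mul_lieExp_eq g
  have hv : v ∉ C := fun hv => hg (Set.mul_mem_mul hk (Set.mem_image_of_mem _ hv))
  simpa only [Set.mem_preimage, hf k hk] using hCs hv

end IsCartanInvolution

variable {M : Type*}

variable (n) in
/-- The function `v ↦ Ψ(x, exp v)` on `𝔭`. By the Cartan decomposition it determines the
left `K`-invariant function `Ψ(x, ·)` on `G`. -/
def pRestriction (θ : G →* G) (Ψ : M → G → ℝ) (x : M) (v : pSpace (n := n) θ) : ℝ :=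
  Ψ x (lieExp (v : GroupLieAlgebra (𝓡 n) G))

lemma weightSlope_eq_coe_radialDeriv (Ψ : M → G → ℝ) (x : M) (v : pSpace (n := n) θ) (t : ℝ) :
    weightSlope Ψ x (v : GroupLieAlgebra (𝓡 n) G) t =
      (radialDeriv (pRestriction n θ Ψ x) v t : EReal) := rfl

variable [TopologicalSpace M] [MulAction G M] {Ψ : M → G → ℝ}

namespace IsKempfNessFunction

lemma apply_one (hΨ : IsKempfNessFunction n θ Ψ) (x : M) : Ψ x 1 = 0 := by
  simpa using hΨ.cocycle x 1 1

lemma tendsto_cocompact_smul [ContinuousMul G] (hΨ : IsKempfNessFunction n θ Ψ) {x : M}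
    (h : Tendsto (Ψ x) (cocompact G) atTop) (g : G) :
    Tendsto (Ψ (g • x)) (cocompact G) atTop := by
  have hcocycle : Ψ (g • x) = fun h => -Ψ x g + Ψ x (h * g) :=
    funext fun h => eq_neg_add_of_add_eq (hΨ.cocycle x g h)
  rw [hcocycle]
  exact tendsto_atTop_add_const_left _ _
    (h.comp (Homeomorph.mulRight g).isClosedEmbedding.tendsto_cocompact)

lemma tendsto_cocompact_smul_iff [ContinuousMul G] (hΨ : IsKempfNessFunction n θ Ψ) {g : G}
    {x : M} : Tendsto (Ψ (g • x)) (cocompact G) atTop ↔ Tendsto (Ψ x) (cocompact G) atTop :=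
  ⟨fun h => inv_smul_smul g x ▸ hΨ.tendsto_cocompact_smul h g⁻¹,
    fun h => hΨ.tendsto_cocompact_smul h g⟩

lemma contDiff_pRestriction_smul (hθ : IsCartanInvolution n θ) (hΨ : IsKempfNessFunction n θ Ψ)
    (x : M) (v : pSpace (n := n) θ) : ContDiff ℝ ∞ fun t : ℝ => pRestriction n θ Ψ x (t • v) := by
  have hline : ContDiff ℝ ∞ fun t : ℝ => t • (show EuclideanSpace ℝ (Fin n) from v.1) := by fun_prop
  exact ((hΨ.smooth x).comp (hθ.smooth_exp.comp_contMDiff hline.contMDiff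
    fun t => (pSpace (n := n) θ).smul_mem t v.2)).contDiff

lemma isRadiallyConvex_pRestriction (hθ : IsCartanInvolution n θ)
    (hΨ : IsKempfNessFunction n θ Ψ) (x : M) : IsRadiallyConvex (pRestriction n θ Ψ x) where
  differentiable v := (contDiff_pRestriction_smul hθ hΨ x v).differentiable (by simp)
  convexOn v := by
    have hf := contDiff_pRestriction_smul hθ hΨ x v
    refine convexOn_univ_of_deriv2_nonneg (hf.differentiable (by simp))
      ((contDiff_infty_iff_deriv.1 hf).2.differentiable (by simp)) fun t => ?_
    rw [← iteratedDeriv_eq_iterate]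
    exact hΨ.second_deriv_nonneg x v v.2 t

lemma monotone_weightSlope (hθ : IsCartanInvolution n θ) (hΨ : IsKempfNessFunction n θ Ψ) (x : M)
    (v : pSpace (n := n) θ) : Monotone (weightSlope Ψ x (v : GroupLieAlgebra (𝓡 n) G)) :=
  EReal.coe_strictMono.monotone.comp
    ((hΨ.isRadiallyConvex_pRestriction hθ x).monotone_radialDeriv v)

theorem Lam_eq_iSup (hθ : IsCartanInvolution n θ) (hΨ : IsKempfNessFunction n θ Ψ) (x : M)
    (v : pSpace (n := n) θ) :
    Lam Ψ x (v : GroupLieAlgebra (𝓡 n) G) = ⨆ t, weightSlope Ψ x v.1 t :=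
  (tendsto_atTop_iSup (hΨ.monotone_weightSlope hθ x v)).limUnder_eq

theorem tendsto_weightSlope (hθ : IsCartanInvolution n θ) (hΨ : IsKempfNessFunction n θ Ψ)
    (x : M) (v : pSpace (n := n) θ) :
    Tendsto (weightSlope Ψ x (v : GroupLieAlgebra (𝓡 n) G)) atTop (𝓝 (Lam Ψ x v.1)) := by
  rw [hΨ.Lam_eq_iSup hθ]
  exact tendsto_atTop_iSup (hΨ.monotone_weightSlope hθ x v)

theorem Lam_ne_bot (hθ : IsCartanInvolution n θ) (hΨ : IsKempfNessFunction n θ Ψ) (x : M)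
    (v : pSpace (n := n) θ) : Lam Ψ x (v : GroupLieAlgebra (𝓡 n) G) ≠ ⊥ := by
  rw [hΨ.Lam_eq_iSup hθ]
  exact ne_bot_of_le_ne_bot (EReal.coe_ne_bot _) (le_iSup (weightSlope Ψ x v.1) 0)

variable [LieGroup (𝓡 n) ∞ G]

lemma pRestriction_zero (hΨ : IsKempfNessFunction n θ Ψ) (x : M) :
    pRestriction n θ Ψ x 0 = 0 := by
  simp [pRestriction, hΨ.apply_one]

lemma radialDeriv_pRestriction (hΨ : IsKempfNessFunction n θ Ψ) (x : M)
    (v : pSpace (n := n) θ) (t : ℝ) :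
    radialDeriv (pRestriction n θ Ψ x) v t =
      gradientMap θ Ψ (lieExp (t • (v : GroupLieAlgebra (𝓡 n) G)) • x) v := by
  set g : G := lieExp (t • (v : GroupLieAlgebra (𝓡 n) G)) with hg
  have hderiv : HasDerivAt (fun s : ℝ => Ψ (g • x) (lieExp (s • (v : GroupLieAlgebra (𝓡 n) G))))
      (gradientMap θ Ψ (g • x) v) (t - t) := by
    rw [sub_self]
    exact hasDerivAt_comp_lieExp_smul_zero ((hΨ.smooth _).mdifferentiableAt (by simp)) _
  have hshift : ∀ s : ℝ, pRestriction n θ Ψ x (s • v) =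
      Ψ x g + Ψ (g • x) (lieExp ((s - t) • (v : GroupLieAlgebra (𝓡 n) G))) := fun s => by
    rw [hΨ.cocycle, hg, ← lieExp_add_smul, sub_add_cancel]
    rfl
  simp only [radialDeriv, hshift]
  exact ((hderiv.comp_sub_const t t).const_add _).deriv

lemma radialDeriv_pRestriction_zero (hΨ : IsKempfNessFunction n θ Ψ) (x : M)
    (v : pSpace (n := n) θ) :
    radialDeriv (pRestriction n θ Ψ x) v 0 = gradientMap θ Ψ x v := by
  rw [hΨ.radialDeriv_pRestriction, zero_smul, lieExp_zero, one_smul]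

lemma continuous_radialDeriv_pRestriction [ContinuousSMul G M] (hθ : IsCartanInvolution n θ)
    (hΨ : IsKempfNessFunction n θ Ψ) (t : ℝ) :
    Continuous fun q : M × pSpace (n := n) θ => radialDeriv (pRestriction n θ Ψ q.1) q.2 t := by
  simp only [hΨ.radialDeriv_pRestriction]
  have hexp : Continuous fun q : M × pSpace (n := n) θ =>
      (lieExp (t • (q.2 : GroupLieAlgebra (𝓡 n) G)) : G) :=
    hθ.continuous_lieExp.comp (continuous_snd.const_smul t)
  exact (hΨ.continuous_gradientMap.comp (hexp.smul continuous_fst)).clm_apply continuous_snd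

lemma mem_lieAlgebraOf_stabilizer_of_radialDeriv_nonpos (hθ : IsCartanInvolution n θ)
    (hΨ : IsKempfNessFunction n θ Ψ) {y : M} (hy : gradientMap (n := n) θ Ψ y = 0)
    {v : pSpace (n := n) θ} {t : ℝ} (ht : 0 < t)
    (h : radialDeriv (pRestriction n θ Ψ y) v t ≤ 0) :
    (v : GroupLieAlgebra (𝓡 n) G) ∈ lieAlgebraOf (MulAction.stabilizer G y) := by
  have hzero : radialDeriv (pRestriction n θ Ψ y) v 0 = 0 := by
    rw [hΨ.radialDeriv_pRestriction_zero, hy]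
    rfl
  have hdiff : Differentiable ℝ (radialDeriv (pRestriction n θ Ψ y) v) :=
    (contDiff_infty_iff_deriv.1 (contDiff_pRestriction_smul hθ hΨ y v)).2.differentiable (by simp)
  refine (hΨ.second_deriv_eq_zero_iff y v v.2).1 ?_
  rw [iteratedDeriv_succ, iteratedDeriv_one]
  exact deriv_eq_zero_of_monotone_of_le
    ((hΨ.isRadiallyConvex_pRestriction hθ y).monotone_radialDeriv v) ht (hdiff 0)
    (h.trans_eq hzero.symm)

lemma gradientMap_eq_zero_iff (hθ : IsCartanInvolution n θ) (hΨ : IsKempfNessFunction n θ Ψ)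
    {y : M} : gradientMap (n := n) θ Ψ y = 0 ↔ ∀ g, 0 ≤ Ψ y g := by
  refine ⟨fun hy g => ?_, fun hpos => ContinuousLinearMap.ext fun v => ?_⟩
  · obtain ⟨k, hk, v, rfl⟩ := hθ.exists_mul_lieExp_eq g
    rw [hΨ.left_invariant y k hk]
    have htangent := (hΨ.isRadiallyConvex_pRestriction hθ y).tangent_le v 0 1
    rwa [hΨ.radialDeriv_pRestriction_zero, hy, zero_apply, zero_mul, add_zero,
      zero_smul, one_smul, hΨ.pRestriction_zero] at htangent
  · rw [← hΨ.radialDeriv_pRestriction_zero]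
    refine radialDeriv_eq_zero_of_forall_le fun w => ?_
    rw [zero_smul, hΨ.pRestriction_zero]
    exact hpos _

lemma exists_gradientMap_smul_eq_zero (hθ : IsCartanInvolution n θ)
    (hΨ : IsKempfNessFunction n θ Ψ) {x : M} (h : Tendsto (Ψ x) (cocompact G) atTop) :
    ∃ g : G, gradientMap (n := n) θ Ψ (g • x) = 0 := by
  obtain ⟨g, hg⟩ := (hΨ.smooth x).continuous.exists_forall_le h
  refine ⟨g, (hΨ.gradientMap_eq_zero_iff hθ).2 fun h => ?_⟩
  linarith [hΨ.cocycle x g h, hg (h * g)]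

lemma tendsto_cocompact_tfae [ContinuousSMul G M] (hθ : IsCartanInvolution n θ)
    (hΨ : IsKempfNessFunction n θ Ψ) (x : M) :
    List.TFAE [Tendsto (Ψ x) (cocompact G) atTop,
      ∀ v ≠ 0, ∃ t, 0 < radialDeriv (pRestriction n θ Ψ x) v t,
      ∃ t, ∀ v ∈ Metric.sphere 0 1, 0 < radialDeriv (pRestriction n θ Ψ x) v t] := by
  rw [hθ.tendsto_cocompact_iff (hΨ.left_invariant x)]
  exact (hΨ.isRadiallyConvex_pRestriction hθ x).tfae_tendsto_cocompact_atTop fun t =>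
    (hΨ.continuous_radialDeriv_pRestriction hθ t).comp (Continuous.prodMk_right x)

lemma tendsto_cocompact_iff_of_gradientMap_eq_zero [ContinuousSMul G M]
    (hθ : IsCartanInvolution n θ) (hΨ : IsKempfNessFunction n θ Ψ) {y : M}
    (hy : gradientMap (n := n) θ Ψ y = 0) :
    Tendsto (Ψ y) (cocompact G) atTop ↔
      ∀ v : pSpace (n := n) θ,
        (v : GroupLieAlgebra (𝓡 n) G) ∈ lieAlgebraOf (MulAction.stabilizer G y) → v = 0 := by
  have hslope := (hΨ.tendsto_cocompact_tfae hθ y).out 0 1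
  rw [hslope]
  refine ⟨fun hpos v hv => ?_, fun hfree v => ?_⟩
  · by_contra hne
    obtain ⟨t, ht⟩ := hpos v hne
    rw [hΨ.radialDeriv_pRestriction, MulAction.mem_stabilizer_iff.1 (hv t), hy] at ht
    exact lt_irrefl _ ht
  · contrapose!
    exact fun hnonpos => hfree v
      (hΨ.mem_lieAlgebraOf_stabilizer_of_radialDeriv_nonpos hθ hy one_pos (hnonpos 1))

lemma stabilizer_le_fixedSubgroup (hθ : IsCartanInvolution n θ)
    (hΨ : IsKempfNessFunction n θ Ψ) {y : M} (hy : gradientMap (n := n) θ Ψ y = 0)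
    (hfree : ∀ v : pSpace (n := n) θ,
      (v : GroupLieAlgebra (𝓡 n) G) ∈ lieAlgebraOf (MulAction.stabilizer G y) → v = 0) :
    MulAction.stabilizer G y ≤ fixedSubgroup θ := by
  intro g hg
  have hpos := (hΨ.gradientMap_eq_zero_iff hθ).1 hy
  have hle : Ψ y g ≤ 0 := by
    have hinv := hΨ.cocycle y g g⁻¹
    rw [MulAction.mem_stabilizer_iff.1 hg, inv_mul_cancel, hΨ.apply_one] at hinv
    linarith [hpos g⁻¹]
  obtain ⟨k, hk, v, rfl⟩ := hθ.exists_mul_lieExp_eq g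
  rw [hΨ.left_invariant y k hk] at hle
  have hcrit : radialDeriv (pRestriction n θ Ψ y) v 1 = 0 :=
    radialDeriv_eq_zero_of_forall_le fun w => by
      rw [one_smul]
      exact hle.trans (hpos _)
  obtain rfl := hfree v
    (hΨ.mem_lieAlgebraOf_stabilizer_of_radialDeriv_nonpos hθ hy one_pos hcrit.le)
  simpa using hk

theorem isStable_iff_tendsto_cocompact [ContinuousSMul G M] (hθ : IsCartanInvolution n θ)
    (hΨ : IsKempfNessFunction n θ Ψ) {x : M} :
    IsStable n θ Ψ x ↔ Tendsto (Ψ x) (cocompact G) atTop := by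
  have := topologicalGroup_of_lieGroup (𝓡 n) ∞ (G := G)
  constructor
  · rintro ⟨⟨_, ⟨g, rfl⟩, hy⟩, a, ha⟩
    rw [← hΨ.tendsto_cocompact_smul_iff (g := g),
      hΨ.tendsto_cocompact_iff_of_gradientMap_eq_zero hθ hy]
    refine fun v hv => hθ.eq_zero_of_Ad_mem_kSpace (g := a * g⁻¹) ?_
    rw [Ad_mul]
    refine ha _ ?_
    rwa [← inv_smul_smul g x, Ad_mem_lieAlgebraOf_stabilizer_smul_iff]
  · intro h
    obtain ⟨g, hy⟩ := hΨ.exists_gradientMap_smul_eq_zero hθ h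
    have hfree := (hΨ.tendsto_cocompact_iff_of_gradientMap_eq_zero hθ hy).1
      (hΨ.tendsto_cocompact_smul h g)
    refine ⟨⟨g • x, MulAction.mem_orbit x g, hy⟩, g, fun v hv => ?_⟩
    rw [← SetLike.mem_coe, coe_kSpace hθ.mdifferentiable]
    exact fun t => hΨ.stabilizer_le_fixedSubgroup hθ hy hfree
      (Ad_mem_lieAlgebraOf_stabilizer_smul_iff.2 hv t)

theorem isOpen_setOf_isStable [ContinuousSMul G M] (hθ : IsCartanInvolution n θ)
    (hΨ : IsKempfNessFunction n θ Ψ) : IsOpen {x : M | IsStable n θ Ψ x} := by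
  have hstable (x : M) : IsStable n θ Ψ x ↔
      ∃ t, ∀ v ∈ Metric.sphere 0 1, 0 < radialDeriv (pRestriction n θ Ψ x) v t :=
    (hΨ.isStable_iff_tendsto_cocompact hθ).trans ((hΨ.tendsto_cocompact_tfae hθ x).out 0 2)
  simp only [hstable]
  refine isOpen_iff_mem_nhds.2 fun x ⟨t, ht⟩ => ?_
  have hopen : IsOpen {q : M × pSpace (n := n) θ |
      0 < radialDeriv (pRestriction n θ Ψ q.1) q.2 t} :=
    isOpen_lt continuous_const (hΨ.continuous_radialDeriv_pRestriction hθ t)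
  have hnear : ∀ᶠ x' in 𝓝 x, ∀ v ∈ Metric.sphere (0 : pSpace (n := n) θ) 1,
      0 < radialDeriv (pRestriction n θ Ψ x') v t :=
    (isCompact_sphere 0 1).eventually_forall_of_forall_eventually fun v hv =>
      hopen.mem_nhds (ht v hv)
  exact hnear.mono fun _ h => ⟨t, h⟩

theorem lowerSemicontinuous_Lam [ContinuousSMul G M] (hθ : IsCartanInvolution n θ)
    (hΨ : IsKempfNessFunction n θ Ψ) :
    LowerSemicontinuous fun q : M × pSpace (n := n) θ =>
      Lam Ψ q.1 (q.2 : GroupLieAlgebra (𝓡 n) G) := by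
  simp only [hΨ.Lam_eq_iSup hθ, weightSlope_eq_coe_radialDeriv]
  exact lowerSemicontinuous_iSup fun t => (continuous_coe_real_ereal.comp
    (hΨ.continuous_radialDeriv_pRestriction hθ t)).lowerSemicontinuous

end IsKempfNessFunction

end CartanInvolution

end KempfNess

end

theorem mainTheorem9_general {n : ℕ} {G : Type*} [TopologicalSpace G]
    [ChartedSpace (EuclideanSpace ℝ (Fin n)) G] [Group G] [LieGroup (𝓡 n) ∞ G]
    {θ : G →* G} (hθ : KempfNess.IsCartanInvolution n θ)
    {M : Type*} [TopologicalSpace M] [MulAction G M] [ContinuousSMul G M]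
    {Ψ : M → G → ℝ} (hΨ : KempfNess.IsKempfNessFunction n θ Ψ) :
    (∀ (x : M) (v : KempfNess.pSpace (n := n) θ),
      Tendsto (KempfNess.weightSlope (n := n) Ψ x v) atTop (𝓝 (KempfNess.Lam (n := n) Ψ x v)) ∧
        KempfNess.Lam (n := n) Ψ x v ≠ ⊥) ∧
    LowerSemicontinuous
      (fun q : M × KempfNess.pSpace (n := n) θ => KempfNess.Lam (n := n) Ψ q.1 q.2) ∧
    IsOpen {x : M | KempfNess.IsStable n θ Ψ x} :=
  ⟨fun x v => ⟨hΨ.tendsto_weightSlope hθ x v, hΨ.Lam_ne_bot hθ x v⟩,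
    hΨ.lowerSemicontinuous_Lam hθ, hΨ.isOpen_setOf_isStable hθ⟩

theorem mainTheorem9 {n : ℕ} {G : Type*} [TopologicalSpace G]
    [ChartedSpace (EuclideanSpace ℝ (Fin n)) G] [Group G] [LieGroup (𝓡 n) ∞ G] [T2Space G]
    (θ : G →* G) (hG : KempfNess.IsNoncompactReductive n θ)
    (B : LinearMap.BilinForm ℝ (KempfNess.pSpace (n := n) θ))
    (hB : KempfNess.IsInvariantScalarProduct θ B)
    {M : Type*} [TopologicalSpace M] [T2Space M] [MulAction G M] [ContinuousSMul G M]
    (Ψ : M → G → ℝ) (hΨ : KempfNess.IsKempfNessFunction n θ Ψ) :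
    (∀ (x : M) (v : KempfNess.pSpace (n := n) θ),
      Tendsto (KempfNess.weightSlope (n := n) Ψ x v) atTop (𝓝 (KempfNess.Lam (n := n) Ψ x v)) ∧
        KempfNess.Lam (n := n) Ψ x v ≠ ⊥) ∧
    LowerSemicontinuous
      (fun q : M × {v : KempfNess.pSpace (n := n) θ // B v v = 1} =>
        KempfNess.Lam (n := n) Ψ q.1 (q.2 : KempfNess.pSpace (n := n) θ)) ∧
    IsOpen {x : M | KempfNess.IsStable n θ Ψ x} := by
  obtain ⟨hlim, hlsc, hopen⟩ := mainTheorem9_general hG.cartan hΨ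
  have hincl : Continuous fun q : M × {v : KempfNess.pSpace (n := n) θ // B v v = 1} =>
      (q.1, q.2.1) := continuous_id.prodMap continuous_subtype_val
  have hlsc_sphere := hlsc.comp hincl
  exact ⟨hlim, hlsc_sphere, hopen⟩
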